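/- Let $X$ be a path-connected space (for instance a connected CW-complex), let $x_0\in X$, let $G=\pi_1(X,x_0)$, and let $\chi\colon G\twoheadrightarrow A$ be an epimorphism onto a finite cyclic group $A$ with a chosen generator $\alpha$. Let $p\colon X^{\chi}\to X$ be the regular cover classified by $\chi$, with base point $y_0\in p^{-1}(x_0)$: $A$ acts on $X^\chi$ as the group of deck transformations, and the lift starting at $y_0$ of a loop $\gamma$ at $x_0$ ends at $\chi(\gamma)\cdot y_0$. Let $\Bbbk$ be an algebraically closed field with $\operatorname{char}(\Bbbk)\nmid |A|$, and let $q\ge 0$ be such that $H_q(X^\chi,\Bbbk)$ is finite-dimensional (which is the case if $X$ is a CW-complex with finite $q$-skeleton). For a character $\rho\in\operatorname{Hom}(G,\Bbbk^*)$ let $\Bbbk_\rho$ be the rank one local system on $X$ in which parallel transport along a loop $\gamma$ at $x_0$ is multiplication by $\rho(\gamma)$. For $s\ge 1$ put $\mathcal V^q_s(X,\Bbbk)=\{\rho\in \operatorname{Hom}(G,\Bbbk^*) : \dim_\Bbbk H_q(X,\Bbbk_\rho)\ge s\}$. Let $\widehat\chi\colon \operatorname{Hom}(A,\Bbbk^*)\to\operatorname{Hom}(G,\Bbbk^*)$,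 $\iota\mapsto\iota\circ\chi$, and for $\rho\in\operatorname{im}(\widehat\chi)$ let $\iota_\rho\colon A\to\Bbbk^*$ be the unique character with $\rho=\iota_\rho\circ\chi$. Let $h_*\colon H_q(X^\chi,\Bbbk)\to H_q(X^\chi,\Bbbk)$ be the map induced in singular homology by the deck transformation $h\colon y\mapsto\alpha\cdot y$. Then each set $\operatorname{im}(\widehat\chi)\cap\mathcal V^q_s(X,\Bbbk)$ is finite, it is empty for all sufficiently large $s$, and the characteristic polynomial of $h_*$ is $$\det(t\cdot\mathrm{id}-h_*)=\prod_{s\ge 1}\ \prod_{\rho\in \operatorname{im}(\widehat\chi)\cap \mathcal V^q_s(X,\Bbbk)}\bigl(t-\iota_\rho(\alpha)\bigr).$$ In particular, $h_*$ is diagonalizable. -/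

import Mathlib

open CategoryTheory

universe u v w

/-! ### Singular homology with coefficients in a rank one local system -/

namespace RankOne

/-- The topological simplex is contractible, hence simply connected. -/
theorem simplyConnectedSpace_stdSimplex (n : ℕ) :
    SimplyConnectedSpace (stdSimplex ℝ (Fin (n + 1))) := by
  have : ContractibleSpace (stdSimplex ℝ (Fin (n + 1))) :=
    (convex_stdSimplex ℝ (Fin (n + 1))).contractibleSpace
      ⟨_, (stdSimplex.vertex (S := ℝ) (0 : Fin (n + 1))).2⟩
  infer_instance

/-- The initial vertex `v₀` of the standard simplex. -/
noncomputable def initialVertex (n : SimplexCategory) : stdSimplex ℝ (Fin (n.len + 1)) :=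
  stdSimplex.vertex 0

/-- A singular simplex, viewed as a continuous map on the standard simplex. -/
noncomputable def asMap {X : TopCat.{u}} {n : SimplexCategoryᵒᵖ} (σ : (TopCat.toSSet.obj X).obj n) :
    C(stdSimplex ℝ (Fin (n.unop.len + 1)), X) :=
  TopCat.toSSetObjEquiv X n σ

theorem asMap_map {X : TopCat.{u}} {m n : SimplexCategoryᵒᵖ} (θ : m ⟶ n)
    (σ : (TopCat.toSSet.obj X).obj m) (t : stdSimplex ℝ (Fin (n.unop.len + 1))) :
    asMap ((TopCat.toSSet.obj X).map θ σ) t = asMap σ (stdSimplex.map θ.unop t) := rfl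

/-- The fibre point of a singular simplex `σ`: the image `σ(v₀)` of the initial vertex, as an
object of the fundamental groupoid. -/
noncomputable def basePoint {X : TopCat.{u}} {n : SimplexCategoryᵒᵖ}
    (σ : (TopCat.toSSet.obj X).obj n) : FundamentalGroupoid X :=
  ⟨asMap σ (initialVertex n.unop)⟩

/-- For a simplicial operator `θ` and a singular simplex `σ`, the homotopy class of the image under
`σ` of a path inside the standard simplex from `v₀` to the initial vertex of the face (or
degeneracy) `θ^* σ`. All such paths are homotopic. For the faces omitting a vertex other than `v₀`
it is the constant path; for the face omitting `v₀` it is the edge from `v₀` to `v₁`. -/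
noncomputable def leadingEdge {X : TopCat.{u}} {m n : SimplexCategoryᵒᵖ} (θ : m ⟶ n)
    (σ : (TopCat.toSSet.obj X).obj m) :
    basePoint σ ⟶ basePoint ((TopCat.toSSet.obj X).map θ σ) :=
  (FundamentalGroupoid.map (asMap σ)).map
    (X := ⟨initialVertex m.unop⟩) (Y := ⟨stdSimplex.map θ.unop (initialVertex n.unop)⟩)
    (Path.Homotopic.Quotient.mk (PathConnectedSpace.somePath _ _))

/-- A rank one local system over the ring `k` on `X`, all of whose fibres have been identified with
`k`: every path class from `x` to `y` acts by a unit of `k`, the parallel transport from the fibre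
at `x` to the fibre at `y`, compatibly with concatenation of paths. -/
abbrev LocalSystem (k : Type v) [CommRing k] (X : Type u) [TopologicalSpace X] :=
  FundamentalGroupoid X ⥤ SingleObj kˣ

/-- Parallel transport in a rank one local system. -/
def LocalSystem.transport {k : Type v} [CommRing k] {X : Type u} [TopologicalSpace X]
    (L : LocalSystem k X) {x y : FundamentalGroupoid X} (η : x ⟶ y) : kˣ :=
  L.map η

section transport

variable {k : Type v} [CommRing k] {X : Type u} [TopologicalSpace X] (L : LocalSystem k X)

theorem LocalSystem.transport_id (x : FundamentalGroupoid X) : L.transport (𝟙 x) = 1 :=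
  L.map_id x

theorem LocalSystem.transport_comp {x y z : FundamentalGroupoid X} (η : x ⟶ y) (ξ : y ⟶ z) :
    L.transport (η ≫ ξ) = L.transport η * L.transport ξ :=
  (L.map_comp η ξ).trans (mul_comm (G := kˣ) _ _)

end transport

/-- The parallel transport along the leading edge. -/
noncomputable def weight {k : Type v} [CommRing k] {X : TopCat.{u}} (L : LocalSystem k X)
    {m n : SimplexCategoryᵒᵖ} (θ : m ⟶ n) (σ : (TopCat.toSSet.obj X).obj m) : kˣ :=
  L.transport (leadingEdge θ σ)

section weight

variable {k : Type v} [CommRing k] {X : TopCat.{u}} (L : LocalSystem k X)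

/-- Transport along the image of a path in a standard simplex only depends on its end points. -/
theorem transport_map_eq {n : ℕ} (f : C(stdSimplex ℝ (Fin (n + 1)), X))
    {a b : FundamentalGroupoid (stdSimplex ℝ (Fin (n + 1)))} (p q : a ⟶ b) :
    L.transport ((FundamentalGroupoid.map f).map p) =
      L.transport ((FundamentalGroupoid.map f).map q) := by
  have := simplyConnectedSpace_stdSimplex n
  have h : p = q := Subsingleton.elim (α := Path.Homotopic.Quotient a.as b.as) p q
  rw [h]

theorem transport_map_self {n : ℕ} (f : C(stdSimplex ℝ (Fin (n + 1)), X))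
    {a b : FundamentalGroupoid (stdSimplex ℝ (Fin (n + 1)))} (h : a = b) (p : a ⟶ b) :
    L.transport ((FundamentalGroupoid.map f).map p) = 1 := by
  subst h
  rw [transport_map_eq L f p (𝟙 a), CategoryTheory.Functor.map_id, L.transport_id]

theorem transport_map_congr {n : ℕ} (f : C(stdSimplex ℝ (Fin (n + 1)), X))
    {a b b' : FundamentalGroupoid (stdSimplex ℝ (Fin (n + 1)))} (h : b = b') (p : a ⟶ b)
    (q : a ⟶ b') :
    L.transport ((FundamentalGroupoid.map f).map p) =
      L.transport ((FundamentalGroupoid.map f).map q) := by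
  subst h
  exact transport_map_eq L f p q

theorem weight_id {m : SimplexCategoryᵒᵖ} (σ : (TopCat.toSSet.obj X).obj m) :
    weight L (𝟙 m) σ = 1 := by
  refine transport_map_self L _ ?_ _
  have : stdSimplex.map (S := ℝ) (𝟙 m : m ⟶ m).unop (initialVertex m.unop) =
    initialVertex m.unop := stdSimplex.map_id_apply _
  rw [this]

theorem weight_comp {l m n : SimplexCategoryᵒᵖ} (θ : l ⟶ m) (ψ : m ⟶ n)
    (σ : (TopCat.toSSet.obj X).obj l) :
    weight L (θ ≫ ψ) σ = weight L θ σ * weight L ψ ((TopCat.toSSet.obj X).map θ σ) := by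
  let e₁ : (⟨initialVertex l.unop⟩ : FundamentalGroupoid _) ⟶
      ⟨stdSimplex.map θ.unop (initialVertex m.unop)⟩ :=
    Path.Homotopic.Quotient.mk (PathConnectedSpace.somePath _ _)
  let e₂ : (⟨initialVertex m.unop⟩ : FundamentalGroupoid _) ⟶
      ⟨stdSimplex.map ψ.unop (initialVertex n.unop)⟩ :=
    Path.Homotopic.Quotient.mk (PathConnectedSpace.somePath _ _)
  let g : C(stdSimplex ℝ (Fin (m.unop.len + 1)), stdSimplex ℝ (Fin (l.unop.len + 1))) :=
    ⟨stdSimplex.map θ.unop, stdSimplex.continuous_map _⟩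
  have h₂ : weight L ψ ((TopCat.toSSet.obj X).map θ σ) =
      L.transport ((FundamentalGroupoid.map (asMap σ)).map
        ((FundamentalGroupoid.map g).map e₂)) := rfl
  have h₁ : weight L θ σ = L.transport ((FundamentalGroupoid.map (asMap σ)).map e₁) := rfl
  have h : stdSimplex.map (S := ℝ) (θ ≫ ψ).unop (initialVertex n.unop) =
      stdSimplex.map θ.unop (stdSimplex.map ψ.unop (initialVertex n.unop)) := by
    rw [stdSimplex.map_comp_apply]
    rfl
  rw [h₁, h₂]
  refine Eq.trans ?_ (L.transport_comp _ _)
  refine Eq.trans ?_ (congrArg L.transport ((FundamentalGroupoid.map (asMap σ)).map_comp e₁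
    ((FundamentalGroupoid.map g).map e₂)))
  exact transport_map_congr L (asMap σ) (congrArg FundamentalGroupoid.mk h) _ _

end weight

/-- The simplicial module of singular chains of `X` with coefficients in `L`. An `n`-chain is a
finite formal sum of singular `n`-simplices `σ` with coefficients in the fibre `k` of `L` over
`σ(v₀)`. A simplicial operator sends `c • σ` to `c' • θ^* σ`, where `c'` is the parallel transport
of `c` from the fibre at `σ(v₀)` to the fibre at `(θ^* σ)(v₀)`. -/
noncomputable def chains {k : Type v} [CommRing k] {X : TopCat.{u}} (L : LocalSystem k X) :
    SimplicialObject (ModuleCat.{max u v} k) where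
  obj n := ModuleCat.of k ((TopCat.toSSet.obj X).obj n →₀ k)
  map {m n} θ := ModuleCat.ofHom <| Finsupp.lsum k fun σ =>
    (weight L θ σ : k) • Finsupp.lsingle ((TopCat.toSSet.obj X).map θ σ)
  map_id m := by
    ext σ : 3
    simp [weight_id]
  map_comp θ ψ := by
    ext σ : 3
    simp [weight_comp, mul_comm]

/-- The homology `H_q(X, L)` of `X` with coefficients in the rank one local system `L`. -/
noncomputable def homology {k : Type v} [CommRing k] {X : TopCat.{u}} (L : LocalSystem k X)
    (q : ℕ) : ModuleCat.{max u v} k :=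
  ((AlgebraicTopology.alternatingFaceMapComplex (ModuleCat.{max u v} k)).obj
    (chains L)).homology q

/-- The rank one local system `k_ρ` attached to a character `ρ` of the fundamental group at `x₀`.
The fibre at `x` is identified with the fibre at `x₀` along a chosen path `c_x` from `x₀` to `x`, so
that transport along `η` from `x` to `y` is `ρ` of the loop `c_x · η · c_y⁻¹`. -/
noncomputable def ofCharacter {k : Type v} [CommRing k] {X : Type u} [TopologicalSpace X]
    [PathConnectedSpace X] (x₀ : X) (ρ : FundamentalGroup X x₀ →* kˣ) : LocalSystem k X where
  obj _ := SingleObj.star kˣ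
  map {x y} η :=
    let c (z : FundamentalGroupoid X) : FundamentalGroupoid.mk x₀ ⟶ z :=
      Path.Homotopic.Quotient.mk (PathConnectedSpace.somePath x₀ z.as)
    ρ (c x ≫ η ≫ Groupoid.inv (c y))
  map_id x := by
    refine Eq.trans ?_ (map_one ρ)
    simp [End.one_def]
  map_comp {x y z} η ξ := by
    refine Eq.trans ?_ (map_mul ρ _ _)
    simp [End.mul_def]

/-- The monodromy of `k_ρ` along a loop `γ` at `x₀` is `ρ(γ)`. -/
theorem transport_ofCharacter {k : Type v} [CommRing k] {X : Type u} [TopologicalSpace X]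
    [PathConnectedSpace X] (x₀ : X) (ρ : FundamentalGroup X x₀ →* kˣ)
    (γ : FundamentalGroup X x₀) : (ofCharacter x₀ ρ).transport γ = ρ γ := by
  let c : FundamentalGroup X x₀ :=
    Path.Homotopic.Quotient.mk (PathConnectedSpace.somePath x₀ x₀)
  have h : (ofCharacter x₀ ρ).transport γ = ρ (c⁻¹ * γ * c) := rfl
  rw [h, map_mul, map_mul, mul_right_comm, ← map_mul, inv_mul_cancel, map_one, one_mul]

end RankOne

/-- The characteristic variety `V^q_s(X, k)`: the characters `ρ` of `π₁(X, x₀)` with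
`dim H_q(X, k_ρ) ≥ s`. -/
def characteristicVariety (k : Type v) [Field k] (X : Type u) [TopologicalSpace X]
    [PathConnectedSpace X] (x₀ : X) (q s : ℕ) : Set (FundamentalGroup X x₀ →* kˣ) :=
  {ρ | (s : Cardinal) ≤
    Module.rank k (RankOne.homology (X := TopCat.of X) (RankOne.ofCharacter x₀ ρ) q)}

/-! ### Characters -/

section characters

variable {G : Type u} [Group G] {A : Type w} [CommGroup A] (k : Type v) [Field k]

/-- The morphism `χ̂` between character groups induced by `χ : G → A`, sending `ι` to `ι ∘ χ`. -/
def dualMap (χ : G →* A) (ι : A →* kˣ) : G →* kˣ := ι.comp χ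

variable {k}

/-- The character `ι_ρ` of `A` with `ρ = ι_ρ ∘ χ`, for `ρ` in the image of `χ̂`. -/
noncomputable def descend (χ : G →* A) {ρ : G →* kˣ} (hρ : ρ ∈ Set.range (dualMap k χ)) :
    A →* kˣ :=
  hρ.choose

theorem descend_comp (χ : G →* A) {ρ : G →* kˣ} (hρ : ρ ∈ Set.range (dualMap k χ)) :
    (descend χ hρ).comp χ = ρ :=
  hρ.choose_spec

theorem eq_descend (χ : G →* A) (hχ : Function.Surjective χ) {ρ : G →* kˣ}
    (hρ : ρ ∈ Set.range (dualMap k χ)) (ι : A →* kˣ) (h : ι.comp χ = ρ) : ι = descend χ hρ :=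
  (MonoidHom.cancel_right hχ).1 (h.trans (descend_comp χ hρ).symm)

end characters

/-! ### Regular covers and the algebraic monodromy -/

/-- `p : Y → X` is a regular cover with group of deck transformations `A`, classified by
`χ : π₁(X, x₀) → A`. That is, `p` is the quotient by an action of `A` on `Y` for which every point
has a neighbourhood with pairwise disjoint translates, and for every loop `γ` at `x₀` the lift of
`γ` to `Y` that starts at `y₀` ends at `χ(γ) • y₀`. In particular `γ` lifts to a loop at `y₀` if and
only if `χ(γ) = 1`, that is, `p_*(π₁(Y, y₀)) = ker χ`; and for surjective `χ` and path connected `X`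
the space `Y` is path connected. -/
structure IsRegularCover {X Y : Type u} [TopologicalSpace X] [TopologicalSpace Y]
    {A : Type w} [CommGroup A] [MulAction A Y] (p : Y → X) (x₀ : X) (y₀ : Y)
    (χ : FundamentalGroup X x₀ →* A) : Prop where
  isQuotientCoveringMap : IsQuotientCoveringMap p A
  map_base : p y₀ = x₀
  lift_endpoint (γ : FundamentalGroup X x₀) :
    (isQuotientCoveringMap.isCoveringMap.monodromy (FundamentalGroup.toPath γ) ⟨y₀, map_base⟩ : Y) =
      χ γ • y₀

/-- Singular homology `H_q(Y, k)`. -/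
noncomputable abbrev singularHomology (k : Type v) [CommRing k] (q : ℕ) (Y : Type u)
    [TopologicalSpace Y] : ModuleCat.{max u v} k :=
  ((AlgebraicTopology.singularHomologyFunctor (ModuleCat.{max u v} k) q).obj
    (ModuleCat.of k (ULift.{u} k))).obj (TopCat.of Y)

/-- The map `h_* : H_q(Y, k) → H_q(Y, k)` induced by the deck transformation `h : y ↦ α • y`. -/
noncomputable def algebraicMonodromy (k : Type v) [CommRing k] (q : ℕ) (Y : Type u)
    [TopologicalSpace Y] {A : Type w} [CommGroup A] [MulAction A Y] [ContinuousConstSMul A Y]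
    (α : A) : singularHomology k q Y →ₗ[k] singularHomology k q Y :=
  (((AlgebraicTopology.singularHomologyFunctor (ModuleCat.{max u v} k) q).obj
    (ModuleCat.of k (ULift.{u} k))).map
      (TopCat.ofHom (⟨fun y => α • y, continuous_const_smul α⟩ : C(Y, Y)))).hom

/-! ### Monodromy and deck transformations of the cover -/

namespace IsQuotientCoveringMap

/-! For a character `ι` of `A`, the local system on `X` attached to `ι ∘ χ` becomes trivial on the
cover `Y`: a horizontal section is `φ = ι ∘ deckCoord`, where `deckCoord y` is the element of `A`
that moves a reference point of the fibre to `y` (`deckCoord_eq_mul`). It satisfies `φ (a • y) = ι a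
* φ y`.

Such a `φ` gives two chain maps. The push-forward sends a simplex `τ` of `Y` to `φ(τ(v₀))` times its
image in `X`; the transfer sends a simplex of `X` to the sum of its lifts, weighted by `φ⁻¹`. On
homology, push-forward after transfer is multiplication by `|A|`, and transfer after push-forward is
`∑ ι(a)⁻¹ a_*`, which is `|A|` times the projector onto the `ι`-isotypical part of `H_q(Y)`
(`exists_pushforward_transfer`).

As `|A|` is invertible in `k` and `k` has enough roots of unity, orthogonality of characters makes
these projectors orthogonal with sum the identity. Hence `H_q(Y)` is the product over `ι` of the
twisted homologies of `X` (`bijective_pi_of_isotypical`), with `α` acting on the factor of `ι` by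
the scalar `ι(α)`. This diagonalizes `h_*`, with characteristic polynomial `∏ (t - ι(α)) ^ dim`;
counting each factor once for every `s ≤ dim` gives the product over the characteristic varieties
(`finprod_layers`). -/

theorem coe_monodromy_smul {E X G : Type*} [TopologicalSpace E] [TopologicalSpace X] [Group G]
    [MulAction G E] {p : E → X} (hp : IsQuotientCoveringMap p G) {x y : X}
    (γ : Path.Homotopic.Quotient x y) (g : G) (e e' : p ⁻¹' {x}) (h : (e' : E) = g • (e : E)) :
    (hp.isCoveringMap.monodromy γ e' : E) = g • (hp.isCoveringMap.monodromy γ e : E) := by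
  have h' : e' = hp.toPermFiber x g e := Subtype.ext h
  rw [h']
  exact congrArg Subtype.val hp.monodromy_toPermFiber

end IsQuotientCoveringMap

/-- The chosen path class from `x₀` to `x`, as in `RankOne.ofCharacter`. -/
noncomputable def chosenPath {X : Type u} [TopologicalSpace X] [PathConnectedSpace X] (x₀ x : X) :
    FundamentalGroupoid.mk x₀ ⟶ FundamentalGroupoid.mk x :=
  Path.Homotopic.Quotient.mk (PathConnectedSpace.somePath x₀ x)

namespace IsRegularCover

variable {X Y : Type u} [TopologicalSpace X] [PathConnectedSpace X] [TopologicalSpace Y]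
  {A : Type w} [CommGroup A] [MulAction A Y] {p : Y → X} {x₀ : X} {y₀ : Y}
  {χ : FundamentalGroup X x₀ →* A}

/-- The end point of the lift of the chosen path from `x₀` to `x` that starts at `y₀`. -/
noncomputable def liftEnd (hp : IsRegularCover p x₀ y₀ χ) (x : X) : p ⁻¹' {x} :=
  hp.isQuotientCoveringMap.isCoveringMap.monodromy (chosenPath x₀ x) ⟨y₀, hp.map_base⟩

/-- The group element carrying the end point `liftEnd (p y)` to `y`. -/
noncomputable def deckCoord (hp : IsRegularCover p x₀ y₀ χ) (y : Y) : A :=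
  hp.isQuotientCoveringMap.fiberEquivGroup (hp.liftEnd (p y)) ⟨y, rfl⟩

theorem deckCoord_smul_liftEnd (hp : IsRegularCover p x₀ y₀ χ) (y : Y) :
    hp.deckCoord y • (hp.liftEnd (p y) : Y) = y :=
  hp.isQuotientCoveringMap.fiberEquivGroup_smul_self (hp.liftEnd (p y)) (e' := ⟨y, rfl⟩)

/-- The points `y` and `a • y` share a fibre, hence a reference point; both sides move it to `a •
y`, and the action is free. -/
theorem deckCoord_smul (hp : IsRegularCover p x₀ y₀ χ) (a : A) (y : Y) :
    hp.deckCoord (a • y) = a * hp.deckCoord y := by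
  have := hp.isQuotientCoveringMap.isCancelSMul
  refine IsCancelSMul.right_cancel _ _ (hp.liftEnd (p y) : Y) ?_
  rw [mul_smul, deckCoord_smul_liftEnd]
  conv_lhs => rw [← hp.isQuotientCoveringMap.map_smul a (e := y)]
  rw [deckCoord_smul_liftEnd]

/-- Put `g = deckCoord y` and `g' = deckCoord y'`, and lift the loop in three pieces from `y₀`. The
first chosen path leads to `g⁻¹ • y`, the image of `η` leads on to `g⁻¹ • y' = (g⁻¹ * g') • liftEnd
(p y')`, and the reversed chosen path ends at `(g⁻¹ * g') • y₀`. The classifying property of `χ` and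
freeness then identify `g⁻¹ * g'` with `χ` of the loop. -/
theorem deckCoord_eq_mul (hp : IsRegularCover p x₀ y₀ χ) {y y' : Y}
    (η : Path.Homotopic.Quotient y y') :
    hp.deckCoord y' = hp.deckCoord y *
      χ (chosenPath x₀ (p y) ≫
        (show FundamentalGroupoid.mk (p y) ⟶ FundamentalGroupoid.mk (p y') from
          η.map ⟨p, hp.isQuotientCoveringMap.continuous⟩) ≫
        Groupoid.inv (chosenPath x₀ (p y'))) := by
  have hfree := hp.isQuotientCoveringMap.isCancelSMul
  have hq := hp.isQuotientCoveringMap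
  set cov := hq.isCoveringMap with hcov
  have key := hp.lift_endpoint (chosenPath x₀ (p y) ≫
        (show FundamentalGroupoid.mk (p y) ⟶ FundamentalGroupoid.mk (p y') from
          η.map ⟨p, hp.isQuotientCoveringMap.continuous⟩) ≫
        Groupoid.inv (chosenPath x₀ (p y')))
  have h1 : cov.monodromy (η.map ⟨p, hq.continuous⟩) ⟨y, rfl⟩ = ⟨y', rfl⟩ := cov.monodromy_map η
  have h2 : (y : Y) = hp.deckCoord y • (hp.liftEnd (p y) : Y) :=
    (hp.deckCoord_smul_liftEnd y).symm
  have h3 := hq.coe_monodromy_smul (η.map ⟨p, hq.continuous⟩) (hp.deckCoord y)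
    (hp.liftEnd (p y)) ⟨y, rfl⟩ h2
  rw [h1] at h3
  let c' : Path.Homotopic.Quotient x₀ (p y') := chosenPath x₀ (p y')
  have h4 : (cov.monodromy (η.map ⟨p, hq.continuous⟩) (hp.liftEnd (p y)) : Y) =
      ((hp.deckCoord y)⁻¹ * hp.deckCoord y') • (hp.liftEnd (p y') : Y) := by
    rw [mul_smul, deckCoord_smul_liftEnd, eq_inv_smul_iff]
    exact h3.symm
  have h5 := hq.coe_monodromy_smul (Groupoid.inv (chosenPath x₀ (p y')))
    ((hp.deckCoord y)⁻¹ * hp.deckCoord y') (hp.liftEnd (p y'))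
    (cov.monodromy (η.map ⟨p, hq.continuous⟩) (hp.liftEnd (p y))) h4
  have h6 : cov.monodromy (Groupoid.inv (chosenPath x₀ (p y'))) (hp.liftEnd (p y')) =
      ⟨y₀, hp.map_base⟩ := by
    refine (cov.monodromy_trans_apply _ _ _).symm.trans ?_
    refine Eq.trans ?_ (congrFun cov.monodromy_refl _)
    exact congrArg (fun γ => cov.monodromy γ _) (Groupoid.comp_inv (chosenPath x₀ (p y')))
  rw [h6] at h5
  have h7 := (congrArg Subtype.val ((cov.monodromy_trans_apply (chosenPath x₀ (p y))
    ((η.map ⟨p, hq.continuous⟩).trans (Groupoid.inv (chosenPath x₀ (p y')))) ⟨y₀, hp.map_base⟩).trans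
    (cov.monodromy_trans_apply (η.map ⟨p, hq.continuous⟩) (Groupoid.inv (chosenPath x₀ (p y')))
      (hp.liftEnd (p y))))).symm.trans key
  have h8 := IsCancelSMul.right_cancel _ _ y₀ (h5.symm.trans h7)
  rw [← h8, mul_inv_cancel_left]

end IsRegularCover

/-! ### Horizontal sections, and lifting of singular simplices -/

namespace RankOne

section pullback

variable {k : Type v} [Field k] {X Y : TopCat.{u}} (p : C(Y, X)) (L : LocalSystem k X)

/-- A nowhere vanishing horizontal section of the pull-back of `L` along `p`. -/
def IsHorizontal (φ : Y → kˣ) : Prop :=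
  ∀ {y y' : Y} (η : FundamentalGroupoid.mk y ⟶ FundamentalGroupoid.mk y'),
    φ y' = φ y * L.transport ((FundamentalGroupoid.map p).map η)

/-- The value of a function on `Y` at the initial vertex of a singular simplex. -/
noncomputable def vertexValue (φ : Y → kˣ) {n : SimplexCategoryᵒᵖ}
    (τ : (TopCat.toSSet.obj Y).obj n) : kˣ :=
  φ (asMap τ (initialVertex n.unop))

variable {p L}

/-- The leading edge of `p ∘ τ` is by definition the image under `p` of that of `τ`, so this is
horizontality along a single path. -/
theorem IsHorizontal.vertexValue_map {φ : Y → kˣ} (hφ : IsHorizontal p L φ)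
    {m n : SimplexCategoryᵒᵖ} (θ : m ⟶ n) (τ : (TopCat.toSSet.obj Y).obj m) :
    vertexValue φ ((TopCat.toSSet.obj Y).map θ τ) =
      vertexValue φ τ * weight L θ ((TopCat.toSSet.map (TopCat.ofHom p)).app m τ) :=
  hφ (leadingEdge θ τ)

end pullback

theorem simplex_ext {X : TopCat.{u}} {n : SimplexCategoryᵒᵖ} {σ τ : (TopCat.toSSet.obj X).obj n}
    (h : ∀ t, asMap σ t = asMap τ t) : σ = τ :=
  (TopCat.toSSetObjEquiv X n).injective (ContinuousMap.ext h)

theorem asMap_app {X Y : TopCat.{u}} (f : C(Y, X)) {n : SimplexCategoryᵒᵖ}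
    (τ : (TopCat.toSSet.obj Y).obj n) (t : stdSimplex ℝ (Fin (n.unop.len + 1))) :
    asMap ((TopCat.toSSet.map (TopCat.ofHom f)).app n τ) t = f (asMap τ t) := rfl

theorem locallyPathConnectedSpace_stdSimplex (n : ℕ) :
    LocallyPathConnectedSpace (stdSimplex ℝ (Fin (n + 1))) :=
  (convex_stdSimplex ℝ (Fin (n + 1))).locallyPathConnectedSpace

section quotient

variable {X Y : TopCat.{u}} {A : Type w} [Group A] [MulAction A Y] {p : C(Y, X)}

/-- Singular simplices lift along covering maps. -/
theorem exists_lift (hp : IsQuotientCoveringMap p A) {n : SimplexCategoryᵒᵖ}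
    (σ : (TopCat.toSSet.obj X).obj n) :
    ∃ τ, (TopCat.toSSet.map (TopCat.ofHom p)).app n τ = σ := by
  have := simplyConnectedSpace_stdSimplex n.unop.len
  have := locallyPathConnectedSpace_stdSimplex n.unop.len
  obtain ⟨e, he⟩ := hp.surjective (asMap σ (initialVertex n.unop))
  obtain ⟨F, ⟨-, hF⟩, -⟩ := hp.isCoveringMap.existsUnique_continuousMap_lifts (asMap σ) _ e he
  refine ⟨(TopCat.toSSetObjEquiv Y n).symm F, simplex_ext fun t => ?_⟩
  rw [asMap_app]
  simp only [asMap, Equiv.apply_symm_apply]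
  exact congrFun hF t

variable [ContinuousConstSMul A Y]

/-- The deck transformation `y ↦ a • y`. -/
def deck (Y : TopCat.{u}) [MulAction A Y] [ContinuousConstSMul A Y] (a : A) : C(Y, Y) :=
  ⟨fun y => a • y, continuous_const_smul a⟩

/-- The action of a deck transformation on singular simplices. -/
noncomputable def deckSimplex (a : A) {n : SimplexCategoryᵒᵖ} (τ : (TopCat.toSSet.obj Y).obj n) :
    (TopCat.toSSet.obj Y).obj n :=
  (TopCat.toSSet.map (TopCat.ofHom (deck Y a))).app n τ

theorem asMap_deckSimplex (a : A) {n : SimplexCategoryᵒᵖ} (τ : (TopCat.toSSet.obj Y).obj n)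
    (t : stdSimplex ℝ (Fin (n.unop.len + 1))) : asMap (deckSimplex a τ) t = a • asMap τ t := rfl

theorem deckSimplex_map (a : A) {m n : SimplexCategoryᵒᵖ} (θ : m ⟶ n)
    (τ : (TopCat.toSSet.obj Y).obj m) :
    deckSimplex a ((TopCat.toSSet.obj Y).map θ τ) =
      (TopCat.toSSet.obj Y).map θ (deckSimplex a τ) := rfl

theorem deckSimplex_mul (a b : A) {n : SimplexCategoryᵒᵖ} (τ : (TopCat.toSSet.obj Y).obj n) :
    deckSimplex (a * b) τ = deckSimplex a (deckSimplex b τ) :=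
  simplex_ext fun t => by simp only [asMap_deckSimplex, mul_smul]

theorem app_deckSimplex (hp : IsQuotientCoveringMap p A) (a : A) {n : SimplexCategoryᵒᵖ}
    (τ : (TopCat.toSSet.obj Y).obj n) :
    (TopCat.toSSet.map (TopCat.ofHom p)).app n (deckSimplex a τ) =
      (TopCat.toSSet.map (TopCat.ofHom p)).app n τ :=
  simplex_ext fun _ => hp.map_smul a

/-- Two lifts of a singular simplex differ by a deck transformation. -/
theorem exists_deckSimplex_eq (hp : IsQuotientCoveringMap p A) {n : SimplexCategoryᵒᵖ}
    {τ τ' : (TopCat.toSSet.obj Y).obj n}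
    (h : (TopCat.toSSet.map (TopCat.ofHom p)).app n τ =
      (TopCat.toSSet.map (TopCat.ofHom p)).app n τ') : ∃ a : A, deckSimplex a τ' = τ := by
  have := simplyConnectedSpace_stdSimplex n.unop.len
  have h' : ∀ t, p (asMap τ t) = p (asMap τ' t) := fun t => by rw [← asMap_app, h, asMap_app]
  -- `a` is read off at the initial vertex; since the simplex is connected, uniqueness of lifts
  -- carries the agreement to every point.
  obtain ⟨a, ha⟩ := hp.apply_eq_iff_mem_orbit.1 (h' (initialVertex n.unop))
  refine ⟨a, simplex_ext fun t => ?_⟩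
  have := hp.isCoveringMap.eq_of_comp_eq (g₁ := asMap (deckSimplex a τ')) (g₂ := asMap τ)
    (map_continuous _) (map_continuous _) (funext fun t => ?_) (initialVertex n.unop) ha
  · exact congrFun this t
  · simp only [Function.comp_apply, asMap_deckSimplex, hp.map_smul, h']

theorem vertexValue_deckSimplex {k : Type v} [Field k] {φ : Y → kˣ} {ι : A →* kˣ}
    (hφ : ∀ (a : A) y, φ (a • y) = ι a * φ y) (a : A) {n : SimplexCategoryᵒᵖ}
    (τ : (TopCat.toSSet.obj Y).obj n) :
    vertexValue φ (deckSimplex a τ) = ι a * vertexValue φ τ := hφ _ _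

end quotient

/-! ### Chains with constant and with twisted coefficients -/

open Limits

/-- The simplicial module of singular chains of `Y` with constant coefficients. -/
noncomputable abbrev constChains (k : Type v) [CommRing k] (Y : TopCat.{u}) :
    SimplicialObject (ModuleCat.{max u v} k) :=
  ((SimplicialObject.whiskering _ _).obj
    (sigmaConst.obj (ModuleCat.of k (ULift.{u} k)))).obj (TopCat.toSSet.obj Y)

section chains

variable {k : Type v} [Field k] {X Y : TopCat.{u}}

/-- The chain `c • τ`, as a linear function of `c`. -/
noncomputable def simplexIncl {n : SimplexCategoryᵒᵖ} (τ : (TopCat.toSSet.obj Y).obj n) :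
    ULift.{u} k →ₗ[k] (constChains k Y).obj n :=
  (Sigma.ι (fun _ : (TopCat.toSSet.obj Y).obj n => ModuleCat.of k (ULift.{u} k)) τ).hom

theorem constChains_hom_ext {n : SimplexCategoryᵒᵖ} {M : ModuleCat.{max u v} k}
    {f g : (constChains k Y).obj n ⟶ M}
    (h : ∀ τ, f.hom ∘ₗ simplexIncl τ = g.hom ∘ₗ simplexIncl τ) : f = g :=
  Sigma.hom_ext _ _ fun τ => ModuleCat.hom_ext (h τ)

theorem constChains_map_simplexIncl {m n : SimplexCategoryᵒᵖ} (θ : m ⟶ n)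
    (τ : (TopCat.toSSet.obj Y).obj m) (c : ULift.{u} k) :
    ((constChains k Y).map θ).hom (simplexIncl τ c) =
      simplexIncl ((TopCat.toSSet.obj Y).map θ τ) c := by
  have h : Sigma.ι (fun _ : (TopCat.toSSet.obj Y).obj m => ModuleCat.of k (ULift.{u} k)) τ ≫
      (constChains k Y).map θ = Sigma.ι (fun _ : (TopCat.toSSet.obj Y).obj n =>
        ModuleCat.of k (ULift.{u} k)) ((TopCat.toSSet.obj Y).map θ τ) := by
    refine (Sigma.ι_comp_map' _ _ _).trans ?_
    exact Category.id_comp _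
  exact congrArg (fun f => f.hom c) h

/-- The map of simplicial chains induced by a continuous map. -/
noncomputable def constChainsMap (k : Type v) [Field k] (f : Y ⟶ X) :
    constChains k Y ⟶ constChains k X :=
  ((SimplicialObject.whiskering _ _).obj
    (sigmaConst.obj (ModuleCat.of k (ULift.{u} k)))).map (TopCat.toSSet.map f)

theorem constChainsMap_simplexIncl (f : Y ⟶ X) {n : SimplexCategoryᵒᵖ}
    (τ : (TopCat.toSSet.obj Y).obj n) (c : ULift.{u} k) :
    ((constChainsMap k f).app n).hom (simplexIncl τ c) =
      simplexIncl ((TopCat.toSSet.map f).app n τ) c := by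
  have h : Sigma.ι (fun _ : (TopCat.toSSet.obj Y).obj n => ModuleCat.of k (ULift.{u} k)) τ ≫
      (constChainsMap k f).app n = Sigma.ι (fun _ : (TopCat.toSSet.obj X).obj n =>
        ModuleCat.of k (ULift.{u} k)) ((TopCat.toSSet.map f).app n τ) := by
    refine (Sigma.ι_comp_map' _ _ _).trans ?_
    exact Category.id_comp _
  exact congrArg (fun f => f.hom c) h

theorem chains_map_single (L : LocalSystem k X) {m n : SimplexCategoryᵒᵖ} (θ : m ⟶ n)
    (σ : (TopCat.toSSet.obj X).obj m) (c : k) :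
    ((chains L).map θ).hom (Finsupp.single σ c) =
      Finsupp.single ((TopCat.toSSet.obj X).map θ σ) ((weight L θ σ : k) * c) := by
  refine (Finsupp.lsum_single k (fun σ => (weight L θ σ : k) •
    Finsupp.lsingle (R := k) (M := k) ((TopCat.toSSet.obj X).map θ σ)) σ c).trans ?_
  exact Finsupp.smul_single _ _ _

theorem chains_hom_ext {L : LocalSystem k X} {n : SimplexCategoryᵒᵖ} {M : ModuleCat.{max u v} k}
    {f g : (chains L).obj n ⟶ M}
    (h : ∀ σ (c : k), f.hom (Finsupp.single σ c) = g.hom (Finsupp.single σ c)) : f = g :=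
  ModuleCat.hom_ext (Finsupp.lhom_ext h)

end chains

/-! ### Push-forward of chains -/

section projection

variable {k : Type v} [Field k] {X Y : TopCat.{u}} {p : C(Y, X)} {L : LocalSystem k X}
  {φ : Y → kˣ}

/-- The push-forward of chains of `Y` to chains of `X` with coefficients in `L`, in one degree. -/
noncomputable def pushforwardApp (p : C(Y, X)) (L : LocalSystem k X) (φ : Y → kˣ)
    (n : SimplexCategoryᵒᵖ) : (constChains k Y).obj n ⟶ (chains L).obj n :=
  Sigma.desc fun τ : (TopCat.toSSet.obj Y).obj n => ModuleCat.ofHom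
    ((vertexValue φ τ : k) •
      (Finsupp.lsingle ((TopCat.toSSet.map (TopCat.ofHom p)).app n τ) ∘ₗ
        ULift.moduleEquiv.toLinearMap))

theorem pushforwardApp_simplexIncl {n : SimplexCategoryᵒᵖ}
    (τ : (TopCat.toSSet.obj Y).obj n) (c : ULift.{u} k) :
    (pushforwardApp p L φ n).hom (simplexIncl τ c) =
      Finsupp.single ((TopCat.toSSet.map (TopCat.ofHom p)).app n τ)
        ((vertexValue φ τ : k) * c.down) := by
  have h := Sigma.ι_desc (fun τ : (TopCat.toSSet.obj Y).obj n => ModuleCat.ofHom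
    ((vertexValue φ τ : k) •
      (Finsupp.lsingle ((TopCat.toSSet.map (TopCat.ofHom p)).app n τ) ∘ₗ
        (ULift.moduleEquiv : ULift.{u} k ≃ₗ[k] k).toLinearMap))) τ
  exact (congrArg (fun f => f.hom c) h).trans (Finsupp.smul_single _ _ _)

/-- The push-forward of chains of `Y` to chains of `X` with coefficients in `L`, determined by a
horizontal section `φ` of the pull-back of `L`. -/
noncomputable def pushforward (hφ : IsHorizontal p L φ) : constChains k Y ⟶ chains L where
  app n := pushforwardApp p L φ n
  naturality m n θ := by
    refine constChains_hom_ext fun τ => LinearMap.ext fun c => ?_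
    refine (congrArg (pushforwardApp p L φ n).hom (constChains_map_simplexIncl θ τ c)).trans ?_
    refine (pushforwardApp_simplexIncl _ _).trans ?_
    refine Eq.trans ?_ (congrArg ((chains L).map θ).hom (pushforwardApp_simplexIncl τ c)).symm
    refine Eq.trans ?_ (chains_map_single L θ _ _).symm
    rw [hφ.vertexValue_map, Units.val_mul, mul_right_comm, mul_comm (weight L θ _ : k)]
    rfl

theorem pushforward_simplexIncl (hφ : IsHorizontal p L φ) {n : SimplexCategoryᵒᵖ}
    (τ : (TopCat.toSSet.obj Y).obj n) (c : ULift.{u} k) :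
    ((pushforward hφ).app n).hom (simplexIncl τ c) =
      Finsupp.single ((TopCat.toSSet.map (TopCat.ofHom p)).app n τ)
        ((vertexValue φ τ : k) * c.down) :=
  pushforwardApp_simplexIncl τ c

end projection

/-! ### Transfer of chains -/

section transfer

variable {k : Type v} [Field k] {X Y : TopCat.{u}} {A : Type w} [CommGroup A]
  [MulAction A Y] {p : C(Y, X)} {L : LocalSystem k X} {φ : Y → kˣ}
  {ι : A →* kˣ}

/-- A lift of a singular simplex along a covering map. -/
noncomputable def chosenLift (hp : IsQuotientCoveringMap p A) {n : SimplexCategoryᵒᵖ}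
    (σ : (TopCat.toSSet.obj X).obj n) : (TopCat.toSSet.obj Y).obj n :=
  (exists_lift hp σ).choose

theorem app_chosenLift (hp : IsQuotientCoveringMap p A) {n : SimplexCategoryᵒᵖ}
    (σ : (TopCat.toSSet.obj X).obj n) :
    (TopCat.toSSet.map (TopCat.ofHom p)).app n (chosenLift hp σ) = σ :=
  (exists_lift hp σ).choose_spec

variable [ContinuousConstSMul A Y]

/-- The simplices `a • τ` and `τ` have the same image in `X`, and their weights differ by the factor
`ι a`. -/
theorem pushforward_deck (hp : IsQuotientCoveringMap p A) (hφ : IsHorizontal p L φ)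
    (hι : ∀ (a : A) y, φ (a • y) = ι a * φ y) (a : A) {n : SimplexCategoryᵒᵖ}
    (z : (constChains k Y).obj n) :
    ((pushforward hφ).app n).hom (((constChainsMap k (TopCat.ofHom (deck Y a))).app n).hom z) =
      (ι a : k) • ((pushforward hφ).app n).hom z := by
  have h : (constChainsMap k (TopCat.ofHom (deck Y a))).app n ≫ (pushforward hφ).app n =
      ModuleCat.ofHom ((ι a : k) • ((pushforward hφ).app n).hom) := by
    refine constChains_hom_ext fun τ => LinearMap.ext fun c => ?_
    refine (congrArg ((pushforward hφ).app n).hom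
      (constChainsMap_simplexIncl (TopCat.ofHom (deck Y a)) τ c)).trans ?_
    refine (pushforward_simplexIncl hφ _ _).trans ?_
    refine Eq.trans ?_ (congrArg (fun w => (ι a : k) • w) (pushforward_simplexIncl hφ τ c)).symm
    refine Eq.trans ?_ (Finsupp.smul_single _ _ _).symm
    refine congrArg₂ Finsupp.single (app_deckSimplex hp a τ) ?_
    refine (congrArg (fun t : kˣ => (t : k) * c.down) (vertexValue_deckSimplex hι a τ)).trans ?_
    simp [mul_assoc]
  exact congrArg (fun f => f.hom z) h

variable [Fintype A]

/-- The sum of the translates `a • τ` of a singular simplex with coefficients `φ(a • τ(v₀))⁻¹`. -/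
noncomputable def orbitSum (φ : Y → kˣ) {n : SimplexCategoryᵒᵖ}
    (τ : (TopCat.toSSet.obj Y).obj n) : k →ₗ[k] (constChains k Y).obj n :=
  ∑ a : A, (((vertexValue φ (deckSimplex a τ))⁻¹ : kˣ) : k) •
    (simplexIncl (deckSimplex a τ) ∘ₗ ULift.moduleEquiv.symm.toLinearMap)

theorem orbitSum_apply (φ : Y → kˣ) {n : SimplexCategoryᵒᵖ}
    (τ : (TopCat.toSSet.obj Y).obj n) (c : k) :
    orbitSum (A := A) φ τ c = ∑ a : A, simplexIncl (deckSimplex a τ)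
      (((vertexValue φ (deckSimplex a τ))⁻¹ : kˣ) • ULift.up c) := by
  simp only [orbitSum, LinearMap.sum_apply, LinearMap.smul_apply, LinearMap.comp_apply,
    ← map_smul, Units.smul_def]
  rfl

theorem orbitSum_deckSimplex (φ : Y → kˣ) (b : A) {n : SimplexCategoryᵒᵖ}
    (τ : (TopCat.toSSet.obj Y).obj n) :
    orbitSum (A := A) φ (deckSimplex b τ) = orbitSum (A := A) φ τ := by
  refine Fintype.sum_equiv (Equiv.mulRight b) _ _ fun a => ?_
  simp only [Equiv.coe_mulRight, deckSimplex_mul]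

/-- Two lifts are translates of each other, and translating only permutes the terms of the sum; so
the transfer does not depend on the chosen lifts. -/
theorem orbitSum_eq (hp : IsQuotientCoveringMap p A) (φ : Y → kˣ) {n : SimplexCategoryᵒᵖ}
    {τ τ' : (TopCat.toSSet.obj Y).obj n}
    (h : (TopCat.toSSet.map (TopCat.ofHom p)).app n τ =
      (TopCat.toSSet.map (TopCat.ofHom p)).app n τ') :
    orbitSum (A := A) φ τ = orbitSum (A := A) φ τ' := by
  obtain ⟨b, rfl⟩ := exists_deckSimplex_eq hp h
  exact orbitSum_deckSimplex φ b τ'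

/-- All translates of `τ` lie over one simplex of `X`, so moving to the new initial vertex
multiplies each value of `φ` by the same transport. Its inverse, from the weights `φ⁻¹`, cancels the
factor in the coefficient. -/
theorem constChains_map_orbitSum (hp : IsQuotientCoveringMap p A) (hφ : IsHorizontal p L φ)
    {m n : SimplexCategoryᵒᵖ} (θ : m ⟶ n) (τ : (TopCat.toSSet.obj Y).obj m) (c : k) :
    ((constChains k Y).map θ).hom (orbitSum (A := A) φ τ c) =
      orbitSum (A := A) φ ((TopCat.toSSet.obj Y).map θ τ)
        ((weight L θ ((TopCat.toSSet.map (TopCat.ofHom p)).app m τ) : k) * c) := by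
  rw [orbitSum_apply, orbitSum_apply, map_sum]
  refine Finset.sum_congr rfl fun a _ => ?_
  refine (constChains_map_simplexIncl θ _ _).trans ?_
  rw [← deckSimplex_map]
  congr 1
  rw [deckSimplex_map, hφ.vertexValue_map, app_deckSimplex hp]
  refine ULift.ext _ _ ?_
  simp [Units.smul_def]
  field_simp

/-- The transfer of chains of `X` with coefficients in `L` to chains of `Y`, in one degree. -/
noncomputable def transferApp (hp : IsQuotientCoveringMap p A) (L : LocalSystem k X) (φ : Y → kˣ)
    (n : SimplexCategoryᵒᵖ) : (chains L).obj n ⟶ (constChains k Y).obj n :=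
  ModuleCat.ofHom (Finsupp.lsum k fun σ => orbitSum (A := A) φ (chosenLift hp σ))

theorem transferApp_single (hp : IsQuotientCoveringMap p A) {n : SimplexCategoryᵒᵖ}
    (τ : (TopCat.toSSet.obj Y).obj n) (c : k) :
    (transferApp hp L φ n).hom
      (Finsupp.single ((TopCat.toSSet.map (TopCat.ofHom p)).app n τ) c) =
      orbitSum (A := A) φ τ c := by
  refine (Finsupp.lsum_single k
    (fun σ => orbitSum (k := k) (A := A) φ (chosenLift hp σ)) _ c).trans ?_
  exact LinearMap.congr_fun (orbitSum_eq hp φ (app_chosenLift hp _)) c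

/-- The transfer of chains of `X` with coefficients in `L` to chains of `Y`, determined by a
horizontal section `φ` of the pull-back of `L`: it sends a singular simplex to the weighted sum of
its lifts. -/
noncomputable def transfer (hp : IsQuotientCoveringMap p A) (hφ : IsHorizontal p L φ) :
    chains L ⟶ constChains k Y where
  app n := transferApp hp L φ n
  naturality m n θ := by
    refine chains_hom_ext fun σ c => ?_
    obtain ⟨τ, rfl⟩ := exists_lift hp σ
    refine (congrArg (transferApp hp L φ n).hom (chains_map_single L θ _ c)).trans ?_
    refine Eq.trans ?_ (congrArg ((constChains k Y).map θ).hom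
      (transferApp_single (L := L) hp τ c)).symm
    refine (transferApp_single (L := L) hp ((TopCat.toSSet.obj Y).map θ τ) _).trans ?_
    exact (constChains_map_orbitSum hp hφ θ τ c).symm

theorem transfer_single (hp : IsQuotientCoveringMap p A) (hφ : IsHorizontal p L φ)
    {n : SimplexCategoryᵒᵖ} (τ : (TopCat.toSSet.obj Y).obj n) (c : k) :
    ((transfer hp hφ).app n).hom
      (Finsupp.single ((TopCat.toSSet.map (TopCat.ofHom p)).app n τ) c) =
      orbitSum (A := A) φ τ c :=
  transferApp_single hp τ c

/-- Each of the `|A|` lifts contributes the original simplex, its weight `φ⁻¹` being cancelled by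
`φ`. -/
theorem pushforward_transfer (hp : IsQuotientCoveringMap p A) (hφ : IsHorizontal p L φ)
    {n : SimplexCategoryᵒᵖ} (z : (chains L).obj n) :
    ((pushforward hφ).app n).hom (((transfer hp hφ).app n).hom z) = (Fintype.card A : k) • z := by
  have h : (transfer hp hφ).app n ≫ (pushforward hφ).app n =
      ModuleCat.ofHom ((Fintype.card A : k) • LinearMap.id) := by
    refine chains_hom_ext fun σ c => ?_
    obtain ⟨τ, rfl⟩ := exists_lift hp σ
    refine (congrArg ((pushforward hφ).app n).hom (transfer_single hp hφ τ c)).trans ?_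
    rw [orbitSum_apply, map_sum]
    refine (Finset.sum_congr rfl fun a _ => (pushforward_simplexIncl hφ _ _).trans
      (congrArg₂ Finsupp.single (app_deckSimplex hp a τ) (?_ : _ = c))).trans ?_
    · simp [Units.smul_def]
    · refine (Finset.sum_const (M := (chains L).obj n) _).trans ?_
      exact (Nat.cast_smul_eq_nsmul k _ _).symm
  exact congrArg (fun f => f.hom z) h

/-- The translate `a • τ` receives the coefficient `φ(τ(v₀)) * φ(a • τ(v₀))⁻¹ = (ι a)⁻¹`. -/
theorem transfer_pushforward (hp : IsQuotientCoveringMap p A) (hφ : IsHorizontal p L φ)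
    (hι : ∀ (a : A) y, φ (a • y) = ι a * φ y) {n : SimplexCategoryᵒᵖ}
    (z : (constChains k Y).obj n) :
    ((transfer hp hφ).app n).hom (((pushforward hφ).app n).hom z) =
      ∑ a : A, (((ι a)⁻¹ : kˣ) : k) •
        ((constChainsMap k (TopCat.ofHom (deck Y a))).app n).hom z := by
  have h : (pushforward hφ).app n ≫ (transfer hp hφ).app n =
      ModuleCat.ofHom (∑ a : A, (((ι a)⁻¹ : kˣ) : k) •
        ((constChainsMap k (TopCat.ofHom (deck Y a))).app n).hom) := by
    refine constChains_hom_ext fun τ => LinearMap.ext fun c => ?_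
    refine (congrArg ((transfer hp hφ).app n).hom (pushforward_simplexIncl hφ τ c)).trans ?_
    refine (transfer_single hp hφ _ _).trans ?_
    rw [orbitSum_apply]
    simp only [ModuleCat.hom_ofHom, LinearMap.comp_apply, LinearMap.sum_apply,
      LinearMap.smul_apply]
    refine Finset.sum_congr rfl fun a _ => ?_
    refine Eq.trans ?_ (congrArg (fun w => (((ι a)⁻¹ : kˣ) : k) • w)
      (constChainsMap_simplexIncl (TopCat.ofHom (deck Y a)) τ c)).symm
    rw [← map_smul, vertexValue_deckSimplex hι]
    refine congrArg (simplexIncl (deckSimplex a τ)) (ULift.ext _ _ ?_)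
    simp [Units.smul_def]
    field_simp
  refine (congrArg (fun f => f.hom z) h).trans ?_
  simp only [ModuleCat.hom_ofHom, LinearMap.sum_apply, LinearMap.smul_apply]

end transfer

end RankOne

/-! ### Passage to homology -/

theorem HomologicalComplex.homologyMap_smul {R : Type*} [Semiring R] {C : Type*} [Category* C]
    [Preadditive C] [Linear R C] [CategoryWithHomology C] {ι : Type*} {c : ComplexShape ι}
    {K K' : HomologicalComplex C c} (r : R) (f : K ⟶ K') (i : ι) :
    homologyMap (r • f) i = r • homologyMap f i :=
  ShortComplex.homologyMap_smul (C := C) ((shortComplexFunctor C c i).map f) r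

namespace RankOne

section homology

variable {k : Type v} [Field k]

/-- The homology of a simplicial module. -/
noncomputable abbrev simplicialHomology (q : ℕ) (M : SimplicialObject (ModuleCat.{max u v} k)) :
    ModuleCat.{max u v} k :=
  ((AlgebraicTopology.alternatingFaceMapComplex (ModuleCat.{max u v} k)).obj M).homology q

/-- The map on homology induced by a map of simplicial modules. -/
noncomputable def simplicialHomologyMap (q : ℕ) {M N : SimplicialObject (ModuleCat.{max u v} k)}
    (f : M ⟶ N) : simplicialHomology q M →ₗ[k] simplicialHomology q N :=
  (HomologicalComplex.homologyMap
    ((AlgebraicTopology.alternatingFaceMapComplex (ModuleCat.{max u v} k)).map f) q).hom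

theorem simplicialHomologyMap_id (q : ℕ) (M : SimplicialObject (ModuleCat.{max u v} k)) :
    simplicialHomologyMap q (𝟙 M) = LinearMap.id := by
  rw [simplicialHomologyMap, CategoryTheory.Functor.map_id, HomologicalComplex.homologyMap_id]
  rfl

theorem simplicialHomologyMap_comp (q : ℕ) {M N P : SimplicialObject (ModuleCat.{max u v} k)}
    (f : M ⟶ N) (g : N ⟶ P) :
    simplicialHomologyMap q (f ≫ g) = simplicialHomologyMap q g ∘ₗ simplicialHomologyMap q f := by
  rw [simplicialHomologyMap, CategoryTheory.Functor.map_comp, HomologicalComplex.homologyMap_comp]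
  rfl

/-- Carries the chain identities above to homology, from a check on elements in each degree; a
one-point index set gives the case of a scalar multiple. -/
theorem simplicialHomologyMap_eq_sum (q : ℕ) {M N : SimplicialObject (ModuleCat.{max u v} k)}
    {B : Type*} (s : Finset B) (c : B → k) (g : B → (M ⟶ N)) (f : M ⟶ N)
    (h : ∀ n (z : M.obj n), (f.app n).hom z = ∑ b ∈ s, c b • ((g b).app n).hom z) :
    simplicialHomologyMap q f = ∑ b ∈ s, c b • simplicialHomologyMap q (g b) := by
  have h' : (AlgebraicTopology.alternatingFaceMapComplex (ModuleCat.{max u v} k)).map f =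
      ∑ b ∈ s, c b •
        (AlgebraicTopology.alternatingFaceMapComplex (ModuleCat.{max u v} k)).map (g b) := by
    refine HomologicalComplex.hom_ext _ _ fun n => ModuleCat.hom_ext <| LinearMap.ext fun z => ?_
    refine (h _ z).trans ?_
    have h₁ : (∑ b ∈ s, c b •
        (AlgebraicTopology.alternatingFaceMapComplex (ModuleCat.{max u v} k)).map (g b)).f n =
        ∑ b ∈ s, c b • (g b).app (Opposite.op (SimplexCategory.mk n)) :=
      map_sum (HomologicalComplex.Hom.fAddMonoidHom n) _ s
    refine Eq.trans ?_ (congrArg (fun φ => φ.hom z) h₁).symm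
    rw [ModuleCat.hom_sum]
    simp [LinearMap.sum_apply]
  rw [simplicialHomologyMap, h']
  have h₂ : HomologicalComplex.homologyMap (∑ b ∈ s, c b •
        (AlgebraicTopology.alternatingFaceMapComplex (ModuleCat.{max u v} k)).map (g b)) q =
      ∑ b ∈ s, c b • HomologicalComplex.homologyMap
        ((AlgebraicTopology.alternatingFaceMapComplex (ModuleCat.{max u v} k)).map (g b)) q := by
    refine (((HomologicalComplex.homologyFunctor (ModuleCat.{max u v} k) _ q).map_sum _ s)).trans ?_
    exact Finset.sum_congr rfl fun b _ => HomologicalComplex.homologyMap_smul _ _ _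
  rw [h₂, ModuleCat.hom_sum]
  rfl

end homology

section cover

variable {k : Type v} [Field k] {X Y : TopCat.{u}} {A : Type w} [CommGroup A]
  [MulAction A Y] {p : C(Y, X)} {L : LocalSystem k X} {φ : Y → kˣ}
  {ι : A →* kˣ} [ContinuousConstSMul A Y]

theorem algebraicMonodromy_eq (q : ℕ) (a : A) :
    algebraicMonodromy k q Y a =
      simplicialHomologyMap q (constChainsMap k (TopCat.ofHom (deck Y a))) := rfl

theorem algebraicMonodromy_one (q : ℕ) :
    algebraicMonodromy k q Y (1 : A) = LinearMap.id := by
  have h : TopCat.ofHom (deck Y (1 : A)) = 𝟙 Y := by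
    ext y
    exact one_smul A y
  rw [algebraicMonodromy_eq, h, constChainsMap, CategoryTheory.Functor.map_id,
    CategoryTheory.Functor.map_id]
  exact simplicialHomologyMap_id q _

/-- The homology of the base with coefficients in `L` as the `ι`-isotypical part of the homology of
the cover. -/
theorem exists_pushforward_transfer [Fintype A] (hp : IsQuotientCoveringMap p A)
    (hφ : IsHorizontal p L φ) (hι : ∀ (a : A) y, φ (a • y) = ι a * φ y) (q : ℕ) :
    ∃ (F : singularHomology k q Y →ₗ[k] homology L q)
      (S : homology L q →ₗ[k] singularHomology k q Y),
      F ∘ₗ S = (Fintype.card A : k) • LinearMap.id ∧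
      S ∘ₗ F = ∑ a : A, (((ι a)⁻¹ : kˣ) : k) • algebraicMonodromy k q Y a ∧
      ∀ a, F ∘ₗ algebraicMonodromy k q Y a = (ι a : k) • F := by
  refine ⟨simplicialHomologyMap q (pushforward hφ), simplicialHomologyMap q (transfer hp hφ),
    ?_, ?_, fun a => ?_⟩
  · refine (simplicialHomologyMap_comp q (transfer hp hφ) (pushforward hφ)).symm.trans ?_
    refine (simplicialHomologyMap_eq_sum q {()} (fun _ => (Fintype.card A : k)) (fun _ => 𝟙 _) _
      fun n z => ?_).trans ?_
    · rw [Finset.sum_singleton]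
      exact pushforward_transfer hp hφ z
    · rw [Finset.sum_singleton, simplicialHomologyMap_id]
      rfl
  · refine (simplicialHomologyMap_comp q (pushforward hφ) (transfer hp hφ)).symm.trans ?_
    exact simplicialHomologyMap_eq_sum q Finset.univ _ _ _
      fun n z => transfer_pushforward hp hφ hι z
  · refine (simplicialHomologyMap_comp q _ (pushforward hφ)).symm.trans ?_
    refine (simplicialHomologyMap_eq_sum q {()} (fun _ => (ι a : k)) (fun _ => pushforward hφ) _
      fun n z => ?_).trans ?_
    · rw [Finset.sum_singleton]
      exact pushforward_deck hp hφ hι a z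
    · rw [Finset.sum_singleton]
      rfl

end cover

end RankOne

/-! ### Isotypical decomposition and eigenbases -/

/-- A linear representation of a finite commutative group on `V` with values `T`, together with
maps onto spaces `H ι` splitting off the isotypical parts, is the product of the `H ι`. -/
theorem bijective_pi_of_isotypical {k : Type v} [Field k] {A : Type w} [CommGroup A] [Fintype A]
    [HasEnoughRootsOfUnity k (Monoid.exponent A)] (hA : (Fintype.card A : k) ≠ 0) {V : Type*}
    [AddCommGroup V] [Module k V]
    {H : (A →* kˣ) → Type*} [∀ ι, AddCommGroup (H ι)] [∀ ι, Module k (H ι)]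
    (T : A → V →ₗ[k] V) (hT : T 1 = LinearMap.id)
    (F : ∀ ι, V →ₗ[k] H ι) (S : ∀ ι, H ι →ₗ[k] V)
    (hFS : ∀ ι, F ι ∘ₗ S ι = (Fintype.card A : k) • LinearMap.id)
    (hSF : ∀ ι, S ι ∘ₗ F ι = ∑ a : A, (((ι a)⁻¹ : kˣ) : k) • T a)
    (hFT : ∀ ι a, F ι ∘ₗ T a = (ι a : k) • F ι) :
    Function.Bijective (LinearMap.pi F) := by
  classical
  have : Fintype (A →* kˣ) := Fintype.ofFinite _
  have hFS' : ∀ ι x, F ι (S ι x) = (Fintype.card A : k) • x := fun ι x =>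
    LinearMap.congr_fun (hFS ι) x
  have hsurj : ∀ ι, Function.Surjective (F ι) := fun ι x =>
    ⟨S ι ((Fintype.card A : k)⁻¹ • x), by rw [hFS', smul_inv_smul₀ hA]⟩
  -- Writing `x = F ι v` turns the left side into `∑ ι(a)⁻¹ κ(a)` times `F κ v`, and the sum over
  -- `A` of the nontrivial character `ι⁻¹ * κ` vanishes.
  have horth : ∀ ι κ, κ ≠ ι → ∀ x, F κ (S ι x) = 0 := by
    intro ι κ hne x
    obtain ⟨v, rfl⟩ := hsurj ι x
    have h1 : S ι (F ι v) = ∑ a : A, (((ι a)⁻¹ : kˣ) : k) • T a v := by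
      simpa using LinearMap.congr_fun (hSF ι) v
    have h2 : ∀ a, F κ (T a v) = (κ a : k) • F κ v := fun a => LinearMap.congr_fun (hFT κ a) v
    rw [h1, map_sum]
    simp only [map_smul, h2, smul_smul, ← Finset.sum_smul]
    have h3 : ((Units.coeHom k).comp (ι⁻¹ * κ)) ≠ 1 := by
      intro h
      refine hne (MonoidHom.ext fun a => ?_)
      have := DFunLike.congr_fun h a
      simp only [MonoidHom.comp_apply, MonoidHom.mul_apply, MonoidHom.inv_apply,
        Units.coeHom_apply, MonoidHom.one_apply, Units.val_eq_one] at this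
      rw [inv_mul_eq_one] at this
      exact this.symm
    have h4 := sum_hom_units_eq_zero _ h3
    simp only [MonoidHom.comp_apply, MonoidHom.mul_apply, MonoidHom.inv_apply,
        Units.coeHom_apply, Units.val_mul] at h4
    rw [h4, zero_smul]
  -- Dual orthogonality: after exchanging the sums only `a = 1` survives, with coefficient the
  -- number of characters, which is `|A|` because `k` has enough roots of unity.
  have hsum : ∀ v, ∑ ι, S ι (F ι v) = (Fintype.card A : k) • v := by
    intro v
    have h1 : ∀ ι, S ι (F ι v) = ∑ a : A, (((ι a)⁻¹ : kˣ) : k) • T a v := fun ι => by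
      simpa using LinearMap.congr_fun (hSF ι) v
    simp only [h1]
    rw [Finset.sum_comm]
    simp only [← Finset.sum_smul]
    rw [Finset.sum_eq_single 1]
    · have hc := CommGroup.card_monoidHom_of_hasEnoughRootsOfUnity A k
      rw [Nat.card_eq_fintype_card, Nat.card_eq_fintype_card] at hc
      simp [hT, hc]
    · intro a _ ha
      obtain ⟨ψ, hψ⟩ := CommGroup.exists_apply_ne_one_of_hasEnoughRootsOfUnity A k ha
      have h2 : ∑ ι : A →* kˣ, (((ι a)⁻¹ : kˣ) : k) = 0 := by
        -- Inverse evaluation at `a ≠ 1` is a nontrivial character of the dual group.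
        have h3 := sum_hom_units_eq_zero
          ((Units.coeHom k).comp ((MonoidHom.eval a : (A →* kˣ) →* kˣ)⁻¹)) (fun h => hψ <| by
            have := DFunLike.congr_fun h ψ
            simpa using this)
        simpa using h3
      rw [h2, zero_smul]
    · simp
  constructor
  · refine (injective_iff_map_eq_zero _).2 fun v hv => ?_
    have h1 : ∀ ι, F ι v = 0 := fun ι => congrFun hv ι
    have h2 := hsum v
    simp only [h1, map_zero, Finset.sum_const_zero] at h2
    exact (smul_eq_zero.1 h2.symm).resolve_left hA
  · intro x
    refine ⟨∑ ι, S ι ((Fintype.card A : k)⁻¹ • x ι), funext fun κ => ?_⟩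
    rw [LinearMap.pi_apply, map_sum, Finset.sum_eq_single κ]
    · rw [hFS', smul_inv_smul₀ hA]
    · exact fun ι _ hne => horth ι κ hne.symm _
    · simp

theorem LinearMap.charpoly_eq_prod_of_basis {k V ι : Type*} [Field k] [AddCommGroup V] [Module k V]
    [Module.Finite k V] [Fintype ι] (T : V →ₗ[k] V) (b : Module.Basis ι k V)
    (d : ι → k) (h : ∀ i, T (b i) = d i • b i) :
    T.charpoly = ∏ i, (Polynomial.X - Polynomial.C (d i)) := by
  classical
  have hm : LinearMap.toMatrix b b T = Matrix.diagonal d := by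
    ext i j
    rw [LinearMap.toMatrix_apply, h, map_smul, Finsupp.smul_apply, b.repr_self,
      Matrix.diagonal_apply, Finsupp.single_apply]
    by_cases hij : i = j
    · simp [hij]
    · simp [hij, Ne.symm hij]
  rw [← LinearMap.charpoly_toMatrix T b, hm, Matrix.charpoly_diagonal]

/-! ### Characters factoring through `χ`, and the final count -/

theorem dualMap_injective {G : Type u} [Group G] {A : Type w} [CommGroup A] (k : Type v) [Field k]
    {χ : G →* A} (hχ : Function.Surjective χ) : Function.Injective (dualMap k χ) :=
  fun _ _ h => (MonoidHom.cancel_right hχ).1 h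

theorem descend_dualMap {G : Type u} [Group G] {A : Type w} [CommGroup A] {k : Type v} [Field k]
    {χ : G →* A} (hχ : Function.Surjective χ) (ι : A →* kˣ)
    (h : dualMap k χ ι ∈ Set.range (dualMap k χ)) : descend χ h = ι :=
  (eq_descend χ hχ h ι rfl).symm

/-- The loop in `deckCoord_eq_mul` is the one by which `ofCharacter` defines transport, so applying
`ι` suffices. -/
theorem IsRegularCover.isHorizontal {k : Type v} [Field k] {X Y : Type u} [TopologicalSpace X]
    [PathConnectedSpace X] [TopologicalSpace Y] {A : Type w} [CommGroup A] [MulAction A Y]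
    {p : Y → X} {x₀ : X} {y₀ : Y} {χ : FundamentalGroup X x₀ →* A}
    (hp : IsRegularCover p x₀ y₀ χ) (ι : A →* kˣ) :
    RankOne.IsHorizontal (X := TopCat.of X) (Y := TopCat.of Y)
      ⟨p, hp.isQuotientCoveringMap.continuous⟩ (RankOne.ofCharacter x₀ (dualMap k χ ι))
      (fun y => ι (hp.deckCoord y)) := by
  intro y y' η
  exact (congrArg ι (hp.deckCoord_eq_mul η)).trans (map_mul ι _ _)

/-- Counting the elements of a finite family `g` with multiplicities `d`, layer by layer. -/
theorem finprod_layers {B R : Type*} [Fintype B] [CommMonoid R] (g : B → R) (d : B → ℕ) :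
    ∏ᶠ (s : ℕ) (_ : 1 ≤ s), ∏ b, (if s ≤ d b then g b else 1) = ∏ b, g b ^ d b := by
  have hle : ∀ b, d b ≤ Finset.univ.sup d := fun b => Finset.le_sup (Finset.mem_univ b)
  rw [finprod_cond_eq_prod_of_cond_iff (t := Finset.Icc 1 (Finset.univ.sup d)), Finset.prod_comm]
  · refine Finset.prod_congr rfl fun b _ => ?_
    rw [← Finset.prod_filter, Finset.prod_const]
    congr 1
    have : (Finset.Icc 1 (Finset.univ.sup d)).filter (· ≤ d b) = Finset.Icc 1 (d b) := by
      ext s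
      have := hle b
      simp only [Finset.mem_filter, Finset.mem_Icc]
      omega
    rw [this, Nat.card_Icc, Nat.add_sub_cancel]
  · intro s hs
    rw [Finset.mem_Icc]
    refine ⟨fun h => ⟨h, ?_⟩, fun h => h.1⟩
    by_contra hlt
    refine hs (Finset.prod_eq_one fun b _ => if_neg fun hb => hlt (hb.trans (hle b)))

theorem theoremA {k : Type v} [Field k] [IsAlgClosed k]
    {X Y : Type u} [TopologicalSpace X] [PathConnectedSpace X] [TopologicalSpace Y]
    {A : Type w} [CommGroup A] [Finite A] [MulAction A Y] [ContinuousConstSMul A Y]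
    (p : Y → X) (x₀ : X) (y₀ : Y) (χ : FundamentalGroup X x₀ →* A)
    (hχ : Function.Surjective χ) (hp : IsRegularCover p x₀ y₀ χ)
    (α : A) (hα : ∀ a : A, a ∈ Subgroup.zpowers α)
    (hchar : ¬ ringChar k ∣ Nat.card A) (q : ℕ)
    [Module.Finite k (singularHomology k q Y)] :
    -- the product below is a finite product
    (∀ s : ℕ, (Set.range (dualMap k χ) ∩ characteristicVariety k X x₀ q s).Finite) ∧
    (∃ N : ℕ, ∀ s > N, Set.range (dualMap k χ) ∩ characteristicVariety k X x₀ q s = ∅) ∧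
    -- the characteristic polynomial of the algebraic monodromy
    (algebraicMonodromy k q Y α).charpoly =
      ∏ᶠ (s : ℕ) (_ : 1 ≤ s) (ρ : FundamentalGroup X x₀ →* kˣ)
        (hρ : ρ ∈ Set.range (dualMap k χ) ∩ characteristicVariety k X x₀ q s),
          (Polynomial.X - Polynomial.C ((descend χ hρ.1 α : kˣ) : k)) ∧
    -- the algebraic monodromy is diagonalizable
    (∃ (b : Module.Basis (Fin (Module.finrank k (singularHomology k q Y))) k
          (singularHomology k q Y))
        (d : Fin (Module.finrank k (singularHomology k q Y)) → k),
      ∀ i, algebraicMonodromy k q Y α (b i) = d i • b i) := by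
  classical
  have : Fintype A := Fintype.ofFinite A
  have hcard : (Fintype.card A : k) ≠ 0 := fun h => hchar <| by
    rw [Nat.card_eq_fintype_card]
    exact (ringChar.spec k _).1 h
  -- The exponent divides `|A|`, hence is nonzero in `k`; an algebraically closed `k` then has all
  -- roots of unity of that order.
  have hexp : NeZero ((Monoid.exponent A : ℕ) : k) := ⟨fun h => hcard <| by
    obtain ⟨c, hc⟩ := Group.exponent_dvd_card (G := A)
    rw [hc, Nat.cast_mul, h, zero_mul]⟩
  have : Fintype (A →* kˣ) := Fintype.ofFinite _
  let H (ι : A →* kˣ) : ModuleCat.{max u v} k :=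
    RankOne.homology (X := TopCat.of X) (RankOne.ofCharacter x₀ (dualMap k χ ι)) q
  have hq := hp.isQuotientCoveringMap
  choose F S hFS hSF hFT using fun ι : A →* kˣ =>
    RankOne.exists_pushforward_transfer (X := TopCat.of X) (Y := TopCat.of Y)
      (p := ⟨p, hq.continuous⟩) hq (hp.isHorizontal ι)
      (fun a y => (congrArg ι (hp.deckCoord_smul a y)).trans (map_mul ι _ _)) q
  have hbij : Function.Bijective (LinearMap.pi (φ := fun ι => H ι) F) :=
    bijective_pi_of_isotypical hcard (fun a => algebraicMonodromy k q Y a)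
      (RankOne.algebraicMonodromy_one (Y := TopCat.of Y) q) F S hFS hSF hFT
  let e : singularHomology k q Y ≃ₗ[k] ∀ ι, H ι := LinearEquiv.ofBijective _ hbij
  have hfin : ∀ ι, Module.Finite k (H ι) := fun ι =>
    Module.Finite.of_surjective ((LinearMap.proj ι) ∘ₗ e.toLinearMap)
      ((Function.surjective_eval ι).comp e.surjective)
  let d (ι : A →* kˣ) : ℕ := Module.finrank k (H ι)
  -- Bases of the twisted homology groups, glued and transported to the cover, form an eigenbasis:
  -- each vector has a single nonzero component, say at `ι`, where `α` acts by `ι α`.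
  let B : Module.Basis (Σ ι, Fin (d ι)) k (singularHomology k q Y) :=
    (Pi.basis fun ι => Module.finBasis k (H ι)).map e.symm
  have hB : ∀ i, algebraicMonodromy k q Y α (B i) = (i.1 α : k) • B i := by
    intro i
    refine e.injective (funext fun κ => ?_)
    have h1 : e (algebraicMonodromy k q Y α (B i)) κ = (κ α : k) • e (B i) κ :=
      LinearMap.congr_fun (hFT κ α) (B i)
    rw [h1, map_smul, Pi.smul_apply]
    have h2 : e (B i) = Pi.single i.1 (Module.finBasis k (H i.1) i.2) := by
      rw [Module.Basis.map_apply, LinearEquiv.apply_symm_apply, Pi.basis_apply]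
    rw [h2]
    by_cases hκ : κ = i.1
    · rw [hκ]
    · rw [Pi.single_eq_of_ne hκ, smul_zero, smul_zero]
  have hmem : ∀ ι s, dualMap k χ ι ∈ characteristicVariety k X x₀ q s ↔ s ≤ d ι := by
    intro ι s
    change (s : Cardinal) ≤ Module.rank k (H ι) ↔ _
    rw [← Module.finrank_eq_rank, Nat.cast_le]
  refine ⟨fun s => (Set.finite_range _).subset Set.inter_subset_left,
    ⟨Finset.univ.sup d, fun s hs => ?_⟩, ?_, ?_⟩
  · refine Set.eq_empty_of_forall_notMem ?_
    rintro _ ⟨⟨ι, rfl⟩, hι⟩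
    exact absurd (((hmem ι s).1 hι).trans (Finset.le_sup (Finset.mem_univ ι))) (not_le.2 hs)
  -- Grouping the eigenbasis by `ι` gives `∏ (X - ι α) ^ d ι`, which is then split into layers `s ≤
  -- d ι`.
  · rw [LinearMap.charpoly_eq_prod_of_basis _ B _ hB, Fintype.prod_sigma]
    simp only [Finset.prod_const, Finset.card_univ, Fintype.card_fin]
    rw [← finprod_layers]
    refine finprod_congr fun s => finprod_congr fun _ => ?_
    -- For fixed `s` only characters `ι ∘ χ` contribute, and `ι` is determined by `ι ∘ χ`, so the
    -- product over `ρ` becomes one over `ι`.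
    rw [finprod_eq_prod_of_mulSupport_subset (s := Finset.univ.map
      ⟨dualMap k χ, dualMap_injective k hχ⟩), Finset.prod_map]
    · refine Finset.prod_congr rfl fun ι _ => ?_
      split_ifs with h
      · have hι : dualMap k χ ι ∈ Set.range (dualMap k χ) ∩ characteristicVariety k X x₀ q s :=
          ⟨⟨ι, rfl⟩, (hmem ι s).2 h⟩
        refine Eq.symm ((finprod_eq_dif _).trans ((dif_pos hι).trans ?_))
        exact congrArg (fun κ : A →* kˣ => Polynomial.X - Polynomial.C (κ α : k))
          (descend_dualMap hχ ι hι.1)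
      · exact ((finprod_eq_dif _).trans (dif_neg fun hι => h ((hmem ι s).1 hι.2))).symm
    · intro ρ hρ
      rw [Function.mem_mulSupport] at hρ
      by_contra h
      refine hρ ((finprod_eq_dif _).trans (dif_neg fun hι => h ?_))
      obtain ⟨ι, rfl⟩ := hι.1
      simp
  · let f : (Σ ι, Fin (d ι)) ≃ Fin (Module.finrank k (singularHomology k q Y)) :=
      Fintype.equivFinOfCardEq (Module.finrank_eq_card_basis B).symm
    refine ⟨B.reindex f, fun i => ((f.symm i).1 α : k), fun i => ?_⟩
    rw [Module.Basis.reindex_apply, hB]
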